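/- Let $n\ge 0$ and let $G$ be a Zariski closed subgroup of $GL(n,\mathbb C)$ such that $g^*\in G$ for every $g\in G$, where $g^*$ is the conjugate transpose (every such $G$ is reductive). Let $K=G\cap U(n)$, let $\langle\cdot,\cdot\rangle$ be the standard Hermitian inner product on $\mathbb C^n$, and let $\mathrm{Lie}(G)=\{X\in M_n(\mathbb C) : e^{tX}\in G \text{ for all } t\in\mathbb R\}$. Let $v\in\mathbb C^n$ be critical, that is, $\langle Xv,v\rangle=0$ for all $X\in \mathrm{Lie}(G)$, and put $G_v=\{g\in G : gv=v\}$ and $K_v=K\cap G_v$. Then: 1. $g^*\in G_v$ for every $g\in G_v$; 2. $K_v$ is a maximal compact subgroup of $G_v$, i.e. it is compact (in the usual topology) and is not properly contained in any compact subgroup of $G_v$; 3. $G_v$ is the Zariski closure of $K_v$ in $GL(n,\mathbb C)$ (equivalently in $G$, since $G$ is Zariski closed). -/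

import Mathlib

namespace KempfNess

variable {n : ℕ}

/-- A subset of `GL(n, ℂ)` is Zariski closed if it is the set of common zeros in `GL(n, ℂ)` of some
set of complex polynomials in the `n²` matrix entries. (Allowing `1 / det` as a further variable
gives the same sets, since denominators can be cleared.) -/
def IsZariskiClosed (S : Set (GL (Fin n) ℂ)) : Prop :=
  ∃ P : Set (MvPolynomial (Fin n × Fin n) ℂ),
    S = {g : GL (Fin n) ℂ | ∀ p ∈ P,
      MvPolynomial.eval (fun ij => (g : Matrix (Fin n) (Fin n) ℂ) ij.1 ij.2) p = 0}

/-- The Zariski closure in `GL(n, ℂ)`: the intersection of all Zariski closed sets containing `S`. -/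
def zariskiClosure (S : Set (GL (Fin n) ℂ)) : Set (GL (Fin n) ℂ) :=
  ⋂₀ {Z | IsZariskiClosed Z ∧ S ⊆ Z}

/-- The Lie algebra of `G` as a subset of `M_n(ℂ)`: all `X` with `e^{tX} ∈ G` for every real `t`. -/
def lieAlg (G : Subgroup (GL (Fin n) ℂ)) : Set (Matrix (Fin n) (Fin n) ℂ) :=
  {X | ∀ t : ℝ, ∃ g ∈ G, (g : Matrix (Fin n) (Fin n) ℂ) = NormedSpace.exp (t • X)}

/-- `v ∈ ℂⁿ` is critical for `G` if `⟨X v, v⟩ = 0` for all `X ∈ Lie(G)`. -/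
def IsCritical (G : Subgroup (GL (Fin n) ℂ)) (v : EuclideanSpace ℂ (Fin n)) : Prop :=
  ∀ X ∈ lieAlg G, inner ℂ (Matrix.toEuclideanLin X v) v = 0

/-- The stabilizer `G_v = {g ∈ G | g v = v}`. -/
def stab (G : Subgroup (GL (Fin n) ℂ)) (v : EuclideanSpace ℂ (Fin n)) :
    Subgroup (GL (Fin n) ℂ) where
  carrier := {g | g ∈ G ∧ Matrix.toEuclideanLin (g : Matrix (Fin n) (Fin n) ℂ) v = v}
  one_mem' := ⟨G.one_mem, by simp⟩
  mul_mem' := by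
    rintro a b ⟨ha, hav⟩ ⟨hb, hbv⟩
    refine ⟨G.mul_mem ha hb, ?_⟩
    have h : Matrix.toEuclideanLin ((a * b : GL (Fin n) ℂ) : Matrix (Fin n) (Fin n) ℂ) v
        = Matrix.toEuclideanLin (a : Matrix (Fin n) (Fin n) ℂ)
          (Matrix.toEuclideanLin (b : Matrix (Fin n) (Fin n) ℂ) v) := by
      simp [Matrix.toLpLin_apply]
    rw [h, hbv, hav]
  inv_mem' := by
    rintro a ⟨ha, hav⟩
    refine ⟨G.inv_mem ha, ?_⟩
    have h : Matrix.toEuclideanLin ((a⁻¹ : GL (Fin n) ℂ) : Matrix (Fin n) (Fin n) ℂ)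
          (Matrix.toEuclideanLin (a : Matrix (Fin n) (Fin n) ℂ) v) = v := by
      have h1 : ((a⁻¹ : GL (Fin n) ℂ) : Matrix (Fin n) (Fin n) ℂ) *
          (a : Matrix (Fin n) (Fin n) ℂ) = 1 := Units.inv_mul a
      rw [Matrix.toLpLin_apply, Matrix.toLpLin_apply]
      simp only [Matrix.mulVec_mulVec, h1, Matrix.one_mulVec]
    rwa [hav] at h

/-- The unitary group `U(n)`, as a subgroup of `GL(n, ℂ)`. -/
def unitaryGL (n : ℕ) : Subgroup (GL (Fin n) ℂ) where
  carrier := {g | (g : Matrix (Fin n) (Fin n) ℂ) ∈ Matrix.unitaryGroup (Fin n) ℂ}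
  one_mem' := (Matrix.unitaryGroup (Fin n) ℂ).one_mem
  mul_mem' := fun ha hb => (Matrix.unitaryGroup (Fin n) ℂ).mul_mem ha hb
  inv_mem' := by
    intro a ha
    have h : ((a⁻¹ : GL (Fin n) ℂ) : Matrix (Fin n) (Fin n) ℂ)
        = star (a : Matrix (Fin n) (Fin n) ℂ) :=
      Units.inv_eq_of_mul_eq_one_right (Matrix.mem_unitaryGroup_iff.1 ha)
    show ((a⁻¹ : GL (Fin n) ℂ) : Matrix (Fin n) (Fin n) ℂ) ∈ Matrix.unitaryGroup (Fin n) ℂ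
    rw [h]
    exact Unitary.star_mem ha

/-- `L` is a maximal compact subgroup of `H` (for the usual topology of `GL(n, ℂ)`): it is maximal
under inclusion among the compact subgroups of `H`. -/
def IsMaximalCompactIn (L H : Subgroup (GL (Fin n) ℂ)) : Prop :=
  Maximal (fun M : Subgroup (GL (Fin n) ℂ) => M ≤ H ∧ IsCompact (M : Set (GL (Fin n) ℂ))) L

end KempfNess

/-!
Writing `g* g = e^X` with `X` Hermitian, `X = u diag(c_i) u*`, every `g` has the polar decomposition
`g = k e^{X/2}` with `k` unitary. A polynomial in the entries of `k e^{zX}` is an exponential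
polynomial in `z` with real frequencies. By linear independence of characters such a function is
zero as soon as it vanishes at all natural numbers, or at all imaginary numbers
(`eq_zero_of_expEval_eq_zero`, `IsZariskiClosed.mul_flowAt_mem`).

* Natural numbers: if a Zariski closed self-adjoint group `G` contains `g`, it contains `e^{mX}` for
  every natural `m`, hence `e^{zX}` for all complex `z`; so `X ∈ Lie(G)`, and `G` is closed under
  polar decomposition.
* If moreover `g` fixes the critical vector `v`, then `⟨Xv, v⟩ = 0` and `⟨e^X v, v⟩ = ‖gv‖² = ⟨v, v⟩`.
  Comparing with `e^x ≥ 1 + x` eigenvalue by eigenvalue gives `e^X v = v`, whence `g* v = v`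
  (`star_mem_stab`). So `G_v` is again a Zariski closed self-adjoint group, and the other two claims
  are statements about such a group `H`.
* A compact subgroup of `H` containing `H ∩ U(n)` contains, with `g`, all powers of `e^{±X/2}`; these
  are bounded only if `X = 0`, that is, if `g` is unitary (`isMaximalCompactIn_inf_unitaryGL`).
* Imaginary numbers: `k e^{itX}` lies in `H ∩ U(n)` for real `t`, so every Zariski closed set
  containing `H ∩ U(n)` contains `k e^{zX}` for all complex `z`, in particular `g`
  (`zariskiClosure_inf_unitaryGL`).
-/

namespace KempfNess

variable {n : ℕ}

/-! ### Exponential polynomials with real frequencies -/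

/-- Evaluation at `z` of exponential polynomials. An element of the group algebra `ℂ[ℝ]` stands for
the exponential polynomial `∑ a_c e^{cz}`, whose frequencies `c` are real. -/
noncomputable def expEval (z : ℂ) : AddMonoidAlgebra ℂ ℝ →ₐ[ℂ] ℂ :=
  AddMonoidAlgebra.lift ℂ ℂ ℝ
    { toFun := fun c => Complex.exp (z * (c.toAdd : ℝ))
      map_one' := by simp
      map_mul' := fun c d => by simp [mul_add, Complex.exp_add] }

lemma expEval_single (z : ℂ) (c : ℝ) (a : ℂ) :
    expEval z (AddMonoidAlgebra.single c a) = a * Complex.exp (z * c) := by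
  simp [expEval]

/-- An additive map `φ : A →+ ℂ` separates real frequencies if the characters `a ↦ e^{c φ(a)}` for
different real `c` are different. -/
def SeparatesFrequencies {A : Type*} [AddMonoid A] (φ : A →+ ℂ) : Prop :=
  ∀ c d : ℝ, (∀ a, Complex.exp (φ a * c) = Complex.exp (φ a * d)) → c = d

lemma separatesFrequencies_natCast : SeparatesFrequencies (Nat.castAddMonoidHom ℂ) := by
  intro c d h
  have h1 := h 1
  simp only [Nat.coe_castAddMonoidHom, Nat.cast_one, one_mul, ← Complex.ofReal_exp,
    Complex.ofReal_inj] at h1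
  exact Real.exp_injective h1

/-- The embedding `t ↦ it` of `ℝ` into `ℂ`. -/
noncomputable def imaginaryAxis : ℝ →+ ℂ :=
  (AddMonoidHom.mulRight Complex.I).comp Complex.ofRealHom.toAddMonoidHom

lemma imaginaryAxis_apply (t : ℝ) : imaginaryAxis t = t * Complex.I := rfl

lemma separatesFrequencies_imaginaryAxis : SeparatesFrequencies imaginaryAxis := by
  intro c d h
  by_contra hne
  have hcd : c - d ≠ 0 := sub_ne_zero.2 hne
  -- At `t = π / (c - d)` the two characters differ by the factor `e^{iπ} = -1`.
  have h1 := h (Real.pi / (c - d))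
  have h2 : imaginaryAxis (Real.pi / (c - d)) * c
      = imaginaryAxis (Real.pi / (c - d)) * d + Real.pi * Complex.I := by
    have : ((c : ℂ) - d) ≠ 0 := by exact_mod_cast hcd
    rw [imaginaryAxis_apply]
    push_cast
    field_simp
    ring
  rw [h2, Complex.exp_add, Complex.exp_pi_mul_I] at h1
  have := Complex.exp_ne_zero (imaginaryAxis (Real.pi / (c - d)) * d)
  apply this
  linear_combination (-1 / 2 : ℂ) * h1

/-- An exponential polynomial vanishing on the image of a frequency-separating map is zero, by
linear independence of characters. -/
lemma eq_zero_of_expEval_eq_zero {A : Type*} [AddMonoid A] {φ : A →+ ℂ}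
    (hφ : SeparatesFrequencies φ) (p : AddMonoidAlgebra ℂ ℝ) (h : ∀ a, expEval (φ a) p = 0) :
    p = 0 := by
  let χ : ℝ → (Multiplicative A →* ℂ) := fun c =>
    { toFun := fun a => Complex.exp (φ a.toAdd * c)
      map_one' := by simp
      map_mul' := fun a b => by simp [add_mul, Complex.exp_add] }
  have hχ : Function.Injective χ := fun c d hcd =>
    hφ c d fun a => DFunLike.congr_fun hcd (Multiplicative.ofAdd a)
  have hli := (linearIndependent_monoidHom (Multiplicative A) ℂ).comp χ hχ
  rw [linearIndependent_iff] at hli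
  have h0 : p.coeff = 0 := by
    refine hli p.coeff (funext fun a => ?_)
    have ha := h a.toAdd
    rw [expEval, AddMonoidAlgebra.lift_apply] at ha
    rw [Finsupp.linearCombination_apply, Finsupp.sum, Finset.sum_apply]
    exact ha
  ext c
  simp [h0]

/-! ### One-parameter groups in diagonal form -/

/-- The complex one-parameter group `z ↦ u diag(e^{c_i z}) u*` in `GL(n, ℂ)`, for a unitary `u` and
real `c_i`. -/
noncomputable def flow (u : Matrix.unitaryGroup (Fin n) ℂ) (c : Fin n → ℝ) :
    Multiplicative ℂ →* GL (Fin n) ℂ :=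
  MonoidHom.toHomUnits
    { toFun := fun z => (u : Matrix (Fin n) (Fin n) ℂ) *
        Matrix.diagonal (fun i => Complex.exp (z.toAdd * c i)) * star (u : Matrix (Fin n) (Fin n) ℂ)
      map_one' := by simp
      map_mul' := fun z w => by
        have hu : star (u : Matrix (Fin n) (Fin n) ℂ) * u = 1 := Unitary.coe_star_mul_self u
        simp only [toAdd_mul, add_mul, Complex.exp_add, ← Matrix.diagonal_mul_diagonal]
        simp only [Matrix.mul_assoc]
        rw [← Matrix.mul_assoc (star (u : Matrix (Fin n) (Fin n) ℂ)) (u : Matrix (Fin n) (Fin n) ℂ) _,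
          hu, Matrix.one_mul] }

/-- The matrix at complex time `z` of the one-parameter group `flow u c`. -/
noncomputable abbrev flowAt (u : Matrix.unitaryGroup (Fin n) ℂ) (c : Fin n → ℝ) (z : ℂ) :
    GL (Fin n) ℂ := flow u c (Multiplicative.ofAdd z)

variable (u : Matrix.unitaryGroup (Fin n) ℂ) (c : Fin n → ℝ)

lemma coe_flowAt (z : ℂ) : (flowAt u c z : Matrix (Fin n) (Fin n) ℂ) =
    (u : Matrix (Fin n) (Fin n) ℂ) * Matrix.diagonal (fun i => Complex.exp (z * c i)) *
      star (u : Matrix (Fin n) (Fin n) ℂ) := rfl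

lemma flowAt_add (z w : ℂ) : flowAt u c (z + w) = flowAt u c z * flowAt u c w :=
  map_mul (flow u c) _ _

lemma flowAt_zero : flowAt u c 0 = 1 := map_one (flow u c)

lemma flowAt_natCast_mul (m : ℕ) (z : ℂ) : flowAt u c (m * z) = flowAt u c z ^ m := by
  rw [← map_pow, ← ofAdd_nsmul, nsmul_eq_mul]

lemma star_flowAt (z : ℂ) : star (flowAt u c z) = flowAt u c (star z) := by
  apply Units.ext
  simp only [Units.coe_star, coe_flowAt, star_mul, star_star, Matrix.mul_assoc]
  congr 2
  rw [Matrix.star_eq_conjTranspose, Matrix.diagonal_conjTranspose]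
  congr 1
  ext i
  simp [← Complex.exp_conj]

lemma flowAt_imaginaryAxis_mem_unitaryGL (t : ℝ) :
    flowAt u c (imaginaryAxis t) ∈ unitaryGL n := by
  refine Matrix.mem_unitaryGroup_iff'.2 ?_
  have h : star (flowAt u c (imaginaryAxis t)) * flowAt u c (imaginaryAxis t) = 1 := by
    rw [star_flowAt, ← flowAt_add, ← flowAt_zero u c]
    simp [imaginaryAxis_apply]
  simpa using congrArg (Units.val) h

lemma flowAt_ofReal_eq_exp (t : ℝ) : (flowAt u c t : Matrix (Fin n) (Fin n) ℂ) =
    NormedSpace.exp (t • ((u : Matrix (Fin n) (Fin n) ℂ) *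
      Matrix.diagonal (fun i => (c i : ℂ)) * star (u : Matrix (Fin n) (Fin n) ℂ))) := by
  have h := Matrix.exp_units_conj (Unitary.toUnits u)
    (Matrix.diagonal fun i => (t * c i : ℂ))
  have hu : ((Unitary.toUnits u)⁻¹ : GL (Fin n) ℂ).val = star (u : Matrix (Fin n) (Fin n) ℂ) := rfl
  rw [hu, Matrix.exp_diagonal, Unitary.val_toUnits_apply] at h
  have h2 : t • ((u : Matrix (Fin n) (Fin n) ℂ) *
      Matrix.diagonal (fun i => (c i : ℂ)) * star (u : Matrix (Fin n) (Fin n) ℂ)) =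
      (u : Matrix (Fin n) (Fin n) ℂ) * Matrix.diagonal (fun i => (t * c i : ℂ)) *
        star (u : Matrix (Fin n) (Fin n) ℂ) := by
    rw [← Matrix.smul_mul, ← Matrix.mul_smul, ← Matrix.diagonal_smul]
    congr 3
  rw [h2, h, coe_flowAt]
  congr 3
  ext i
  simp [Complex.exp_eq_exp_ℂ, Pi.coe_exp]

open scoped ComplexOrder in
/-- The positive definite matrix `g* g` is the value at time `1` of a diagonal flow. -/
lemma exists_flowAt_one_eq_star_mul_self (g : GL (Fin n) ℂ) :
    ∃ (u : Matrix.unitaryGroup (Fin n) ℂ) (c : Fin n → ℝ), star g * g = flowAt u c 1 := by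
  have hpos : ((g : Matrix (Fin n) (Fin n) ℂ).conjTranspose * g).PosDef :=
    Matrix.PosDef.conjTranspose_mul_self _ (Matrix.mulVec_injective_of_isUnit g.isUnit)
  refine ⟨hpos.isHermitian.eigenvectorUnitary,
    fun i => Real.log (hpos.isHermitian.eigenvalues i), Units.ext ?_⟩
  rw [Units.val_mul, Units.coe_star, Matrix.star_eq_conjTranspose]
  conv_lhs => rw [hpos.isHermitian.spectral_theorem, Unitary.conjStarAlgAut_apply]
  rw [coe_flowAt]
  congr 3
  ext i
  simp [← Complex.ofReal_exp, Real.exp_log (hpos.eigenvalues_pos i)]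

variable {u c}

/-- If a translated diagonal flow lies in a Zariski closed set along a frequency-separating
parameter set, it does so at all complex times: polynomials in its entries are exponential
polynomials with real frequencies. -/
lemma IsZariskiClosed.mul_flowAt_mem {S : Set (GL (Fin n) ℂ)} (hS : IsZariskiClosed S)
    {A : Type*} [AddMonoid A] {φ : A →+ ℂ} (hφ : SeparatesFrequencies φ) {k : GL (Fin n) ℂ}
    (h : ∀ a, k * flowAt u c (φ a) ∈ S) (z : ℂ) : k * flowAt u c z ∈ S := by
  obtain ⟨P, rfl⟩ := hS
  intro p hp
  -- The entries of `k * flowAt u c z` as exponential polynomials in `z`.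
  let E : Fin n × Fin n → AddMonoidAlgebra ℂ ℝ := fun ij =>
    ∑ l, AddMonoidAlgebra.single (c l)
      (((k : Matrix (Fin n) (Fin n) ℂ) * (u : Matrix (Fin n) (Fin n) ℂ)) ij.1 l *
        star (u : Matrix (Fin n) (Fin n) ℂ) l ij.2)
  have hE : ∀ w, MvPolynomial.eval
      (fun ij => ((k * flowAt u c w : GL (Fin n) ℂ) : Matrix (Fin n) (Fin n) ℂ) ij.1 ij.2) p =
      expEval w (MvPolynomial.aeval E p) := by
    intro w
    have hc : (expEval w).comp (MvPolynomial.aeval E) = MvPolynomial.aeval (fun ij =>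
        ((k * flowAt u c w : GL (Fin n) ℂ) : Matrix (Fin n) (Fin n) ℂ) ij.1 ij.2) := by
      ext ij
      rw [AlgHom.comp_apply, MvPolynomial.aeval_X, MvPolynomial.aeval_X, Units.val_mul, coe_flowAt,
        ← Matrix.mul_assoc, ← Matrix.mul_assoc, Matrix.mul_apply, map_sum]
      refine Finset.sum_congr rfl fun l _ => ?_
      rw [expEval_single, Matrix.mul_diagonal]
      ring
    exact (DFunLike.congr_fun hc p).symm
  have h0 : MvPolynomial.aeval E p = 0 :=
    eq_zero_of_expEval_eq_zero hφ _ fun a => by rw [← hE]; exact h a p hp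
  rw [hE, h0, map_zero]

/-! ### Polar decomposition inside a self-adjoint Zariski closed group -/

section Polar

variable {G : Subgroup (GL (Fin n) ℂ)} {u : Matrix.unitaryGroup (Fin n) ℂ} {c : Fin n → ℝ}

/-- A Zariski closed group containing the time-one value of a diagonal flow, hence its values at all
natural times, contains the whole complex flow. -/
lemma flowAt_mem_of_flowAt_one_mem (hG : IsZariskiClosed (G : Set (GL (Fin n) ℂ)))
    (h1 : flowAt u c 1 ∈ G) (z : ℂ) : flowAt u c z ∈ G := by
  have h := hG.mul_flowAt_mem (u := u) (c := c) separatesFrequencies_natCast (k := 1) (fun m => by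
    have hm := flowAt_natCast_mul u c m 1
    rw [mul_one] at hm
    rw [one_mul, Nat.coe_castAddMonoidHom, hm]
    exact G.pow_mem h1 m) z
  rwa [one_mul] at h

/-- The unitary factor in the polar decomposition `g = (g e^{-X/2}) e^{X/2}`, where `g* g = e^X`. -/
lemma mul_flowAt_neg_half_mem_unitaryGL {g : GL (Fin n) ℂ} (h : star g * g = flowAt u c 1) :
    g * flowAt u c (-(1 / 2)) ∈ unitaryGL n := by
  refine Matrix.mem_unitaryGroup_iff'.2 ?_
  have h1 : star (g * flowAt u c (-(1 / 2))) * (g * flowAt u c (-(1 / 2))) = 1 := by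
    rw [star_mul, star_flowAt, mul_assoc, ← mul_assoc (star g), h, ← flowAt_add, ← flowAt_add,
      ← flowAt_zero u c]
    congr 1
    simp only [one_div, star_neg, star_inv₀, star_ofNat]
    norm_num
  simpa using congrArg Units.val h1

lemma mul_flowAt_neg_half_mul_flowAt_half (g : GL (Fin n) ℂ) :
    g * flowAt u c (-(1 / 2)) * flowAt u c (1 / 2) = g := by
  rw [mul_assoc, ← flowAt_add, neg_add_cancel, flowAt_zero, mul_one]

end Polar

/-! ### Stabilizers of critical vectors -/

lemma mem_stab_iff {G : Subgroup (GL (Fin n) ℂ)} {v : EuclideanSpace ℂ (Fin n)}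
    {g : GL (Fin n) ℂ} : g ∈ stab G v ↔
      g ∈ G ∧ Matrix.mulVec (g : Matrix (Fin n) (Fin n) ℂ) v.ofLp = v.ofLp := by
  change (_ ∧ _) ↔ _
  rw [Matrix.toLpLin_apply]
  refine and_congr_right fun _ => ⟨fun h => congrArg WithLp.ofLp h, fun h => by rw [h]⟩

open scoped Matrix in
/-- The Hermitian form of `u diag(d_i) u*` at `v`, in the coordinates `u* v`. -/
lemma star_dotProduct_conj_diagonal_mulVec (u : Matrix (Fin n) (Fin n) ℂ) (d : Fin n → ℝ)
    (v : Fin n → ℂ) :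
    star v ⬝ᵥ ((u * Matrix.diagonal (fun i => (d i : ℂ)) * star u) *ᵥ v) =
      ((∑ i, d i * ‖(star u *ᵥ v) i‖ ^ 2 : ℝ) : ℂ) := by
  rw [← Matrix.mulVec_mulVec, ← Matrix.mulVec_mulVec, Matrix.dotProduct_mulVec]
  have h : star v ᵥ* u = star (star u *ᵥ v) := by
    rw [Matrix.star_mulVec, Matrix.star_eq_conjTranspose, Matrix.conjTranspose_conjTranspose]
  rw [h, dotProduct]
  push_cast
  refine Finset.sum_congr rfl fun i _ => ?_
  rw [Matrix.mulVec_diagonal, Pi.star_apply, mul_left_comm, RCLike.star_def, Complex.conj_mul']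

open scoped Matrix in
/-- The stabilizer of a critical vector is self-adjoint. Writing `g* g = e^X` for `g` in the
stabilizer, both `⟨Xv, v⟩ = 0` and `⟨e^X v, v⟩ = ⟨v, v⟩`; in an eigenbasis of `X` this forces
`Xv = 0`, because `e^x ≥ 1 + x` with equality only at `0`. -/
lemma star_mem_stab {G : Subgroup (GL (Fin n) ℂ)} (hG : IsZariskiClosed (G : Set (GL (Fin n) ℂ)))
    (hstar : ∀ g ∈ G, star g ∈ G) {v : EuclideanSpace ℂ (Fin n)} (hv : IsCritical G v)
    {g : GL (Fin n) ℂ} (hg : g ∈ stab G v) : star g ∈ stab G v := by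
  obtain ⟨hgG, hgv⟩ := mem_stab_iff.1 hg
  obtain ⟨u, c, huc⟩ := exists_flowAt_one_eq_star_mul_self g
  have hmem : ∀ z, flowAt u c z ∈ G :=
    flowAt_mem_of_flowAt_one_mem hG (huc ▸ G.mul_mem (hstar g hgG) hgG)
  have huc' : star (g : Matrix (Fin n) (Fin n) ℂ) * g = flowAt u c 1 := congrArg Units.val huc
  set U : Matrix (Fin n) (Fin n) ℂ := (u : Matrix (Fin n) (Fin n) ℂ)
  have hUU : U * star U = 1 := Unitary.coe_mul_star_self u
  set w : Fin n → ℂ := star U *ᵥ v.ofLp with hw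
  have hUw : U *ᵥ w = v.ofLp := by rw [hw, Matrix.mulVec_mulVec, hUU, Matrix.one_mulVec]
  have hexp : ((flowAt u c 1 : GL (Fin n) ℂ) : Matrix (Fin n) (Fin n) ℂ) =
      U * Matrix.diagonal (fun i => ((Real.exp (c i) : ℝ) : ℂ)) * star U := by
    rw [coe_flowAt]
    simp [U]
  have hcrit : ∑ i, c i * ‖w i‖ ^ 2 = 0 := by
    have h := hv (U * Matrix.diagonal (fun i => (c i : ℂ)) * star U)
      fun t => ⟨flowAt u c t, hmem t, flowAt_ofReal_eq_exp u c t⟩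
    rw [inner_eq_zero_symm, EuclideanSpace.inner_eq_star_dotProduct, Matrix.toLpLin_apply,
      dotProduct_comm, star_dotProduct_conj_diagonal_mulVec] at h
    exact_mod_cast h
  have hone : star v.ofLp ⬝ᵥ v.ofLp = ((∑ i, ‖w i‖ ^ 2 : ℝ) : ℂ) := by
    have h := star_dotProduct_conj_diagonal_mulVec U (fun _ => 1) v.ofLp
    simpa [hUU] using h
  have hnorm : ∑ i, Real.exp (c i) * ‖w i‖ ^ 2 = ∑ i, ‖w i‖ ^ 2 := by
    have h := star_dotProduct_conj_diagonal_mulVec U (fun i => Real.exp (c i)) v.ofLp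
    rw [← hexp, ← huc', ← Matrix.mulVec_mulVec, hgv, Matrix.dotProduct_mulVec,
      Matrix.star_eq_conjTranspose, ← Matrix.star_mulVec, hgv, hone] at h
    exact_mod_cast h.symm
  have hsum : ∑ i, (Real.exp (c i) - (c i + 1)) * ‖w i‖ ^ 2 = 0 := by
    simp only [sub_mul, add_mul, one_mul, Finset.sum_sub_distrib, Finset.sum_add_distrib]
    rw [hnorm, hcrit]
    ring
  have hterm : ∀ i, c i = 0 ∨ w i = 0 := by
    intro i
    have h := (Finset.sum_eq_zero_iff_of_nonneg fun i _ => mul_nonneg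
      (sub_nonneg.2 (Real.add_one_le_exp (c i))) (sq_nonneg ‖w i‖)).1 hsum i (Finset.mem_univ i)
    rcases mul_eq_zero.1 h with h | h
    · left
      by_contra hc
      linarith [Real.add_one_lt_exp hc]
    · right
      simpa using h
  have hfix : (flowAt u c 1 : Matrix (Fin n) (Fin n) ℂ) *ᵥ v.ofLp = v.ofLp := by
    rw [hexp, ← Matrix.mulVec_mulVec, ← Matrix.mulVec_mulVec, ← hw]
    conv_rhs => rw [← hUw]
    congr 1
    ext i
    rw [Matrix.mulVec_diagonal]
    rcases hterm i with h | h <;> simp [h]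
  refine mem_stab_iff.2 ⟨hstar g hgG, ?_⟩
  -- Since `g` fixes `v`, so does `g*` as soon as `g* g` does.
  rw [Units.coe_star]
  conv_lhs => rw [← hgv]
  rw [Matrix.mulVec_mulVec, huc', hfix]

lemma isZariskiClosed_stab {G : Subgroup (GL (Fin n) ℂ)}
    (hG : IsZariskiClosed (G : Set (GL (Fin n) ℂ))) (v : EuclideanSpace ℂ (Fin n)) :
    IsZariskiClosed (stab G v : Set (GL (Fin n) ℂ)) := by
  obtain ⟨P, hP⟩ := hG
  refine ⟨P ∪ Set.range fun i : Fin n =>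
    ∑ j, MvPolynomial.X (i, j) * MvPolynomial.C (v j) - MvPolynomial.C (v i), ?_⟩
  ext g
  have hg : g ∈ G ↔ g ∈ (G : Set (GL (Fin n) ℂ)) := Iff.rfl
  rw [SetLike.mem_coe, mem_stab_iff, hg, hP]
  simp only [Set.mem_ofPred_eq, Set.mem_union, or_imp, forall_and, Set.forall_mem_range]
  refine and_congr_right fun _ => ?_
  rw [funext_iff]
  refine forall_congr' fun i => ?_
  simp [Matrix.mulVec, dotProduct, sub_eq_zero]

/-! ### Maximality and density of the unitary part -/

lemma IsZariskiClosed.isClosed {S : Set (GL (Fin n) ℂ)} (hS : IsZariskiClosed S) : IsClosed S := by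
  obtain ⟨P, rfl⟩ := hS
  simp only [Set.ofPred_forall]
  refine isClosed_iInter fun p => isClosed_iInter fun _ => isClosed_eq ?_ continuous_const
  refine (MvPolynomial.continuous_eval p).comp (continuous_pi fun ij => ?_)
  exact Units.continuous_val.matrix_elem ij.1 ij.2

lemma isCompact_unitaryGroup :
    IsCompact (Matrix.unitaryGroup (Fin n) ℂ : Set (Matrix (Fin n) (Fin n) ℂ)) := by
  have hK : IsCompact (Set.univ.pi fun _ : Fin n => Set.univ.pi fun _ : Fin n =>
      Metric.closedBall (0 : ℂ) 1) :=
    isCompact_univ_pi fun _ => isCompact_univ_pi fun _ => isCompact_closedBall 0 1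
  refine hK.of_isClosed_subset ?_ fun A hA i _ j _ => ?_
  · have h : (Matrix.unitaryGroup (Fin n) ℂ : Set (Matrix (Fin n) (Fin n) ℂ)) =
        {A | A * star A = 1} := by
      ext A
      exact Matrix.mem_unitaryGroup_iff
    rw [h]
    exact isClosed_eq (by fun_prop) continuous_const
  · simpa using entry_norm_bound_of_unitary hA i j

lemma isCompact_unitaryGL : IsCompact (unitaryGL n : Set (GL (Fin n) ℂ)) := by
  have h := Submonoid.units_isCompact (isCompact_unitaryGroup (n := n))
  convert h using 1
  ext g
  exact ⟨fun hg => ⟨hg, (unitaryGL n).inv_mem hg⟩, fun hg => hg.1⟩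

/-- If a diagonal flow stays in a compact set at all natural multiples of a real time `s`, then it
does not expand over the time `s`: an exponent with `s * c i > 0` would make a diagonal entry of
`u* (flowAt u c (m * s)) u` unbounded in `m`. -/
lemma exponent_nonpos_of_flowAt_mem {M : Set (GL (Fin n) ℂ)} (hM : IsCompact M)
    {u : Matrix.unitaryGroup (Fin n) ℂ} {c : Fin n → ℝ} {s : ℝ}
    (h : ∀ m : ℕ, flowAt u c (m * s) ∈ M) (i : Fin n) : s * c i ≤ 0 := by
  have hcont : Continuous fun g : GL (Fin n) ℂ => (star (u : Matrix (Fin n) (Fin n) ℂ) *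
      (g : Matrix (Fin n) (Fin n) ℂ) * (u : Matrix (Fin n) (Fin n) ℂ)) i i :=
    ((continuous_const.matrix_mul Units.continuous_val).matrix_mul continuous_const).matrix_elem i i
  obtain ⟨B, hB⟩ := hM.exists_bound_of_continuousOn hcont.continuousOn
  have hu : star (u : Matrix (Fin n) (Fin n) ℂ) * (u : Matrix (Fin n) (Fin n) ℂ) = 1 :=
    Unitary.coe_star_mul_self u
  have hbound : ∀ m : ℕ, Real.exp (m * (s * c i)) ≤ B := by
    intro m
    have h1 := hB _ (h m)
    rw [coe_flowAt, Matrix.mul_assoc, Matrix.mul_assoc, hu, Matrix.mul_one, ← Matrix.mul_assoc, hu,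
      Matrix.one_mul, Matrix.diagonal_apply_eq, Complex.norm_exp] at h1
    convert h1 using 2
    simp [mul_assoc]
  by_contra! hpos
  obtain ⟨m, hm⟩ := exists_nat_gt (B / (s * c i))
  rw [div_lt_iff₀ hpos] at hm
  linarith [hbound m, Real.add_one_le_exp (m * (s * c i))]

section Unitary

variable {H : Subgroup (GL (Fin n) ℂ)}

/-- A compact subgroup of `H` containing `H ∩ U(n)` contains the positive definite polar factor of
each of its elements; the powers of that factor stay bounded, so it is trivial. -/
lemma isMaximalCompactIn_inf_unitaryGL (hH : IsZariskiClosed (H : Set (GL (Fin n) ℂ)))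
    (hstar : ∀ g ∈ H, star g ∈ H) : IsMaximalCompactIn (H ⊓ unitaryGL n) H := by
  refine ⟨⟨inf_le_left, ?_⟩, ?_⟩
  · rw [Subgroup.coe_inf, Set.inter_comm]
    exact isCompact_unitaryGL.inter_right hH.isClosed
  rintro M ⟨hMH, hM⟩ hKM g hg
  obtain ⟨u, c, huc⟩ := exists_flowAt_one_eq_star_mul_self g
  have hmem : ∀ z, flowAt u c z ∈ H :=
    flowAt_mem_of_flowAt_one_mem hH (huc ▸ H.mul_mem (hstar g (hMH hg)) (hMH hg))
  have hk : g * flowAt u c (-(1 / 2)) ∈ M :=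
    hKM ⟨H.mul_mem (hMH hg) (hmem _), mul_flowAt_neg_half_mem_unitaryGL huc⟩
  have hneg : flowAt u c (-(1 / 2)) ∈ M := (M.mul_mem_cancel_left hg).1 hk
  have hhalf : flowAt u c (1 / 2) ∈ M := by
    have h := mul_flowAt_neg_half_mul_flowAt_half (u := u) (c := c) g
    exact (M.mul_mem_cancel_left hk).1 (h.symm ▸ hg)
  have hc : c = 0 := by
    funext i
    have h1 : (1 / 2 : ℝ) * c i ≤ 0 := exponent_nonpos_of_flowAt_mem hM (u := u) (fun m => by
      rw [flowAt_natCast_mul]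
      push_cast
      exact M.pow_mem hhalf m) i
    have h2 : (-(1 / 2) : ℝ) * c i ≤ 0 := exponent_nonpos_of_flowAt_mem hM (u := u) (fun m => by
      rw [flowAt_natCast_mul]
      push_cast
      exact M.pow_mem hneg m) i
    rw [Pi.zero_apply]
    linarith
  have h1 : flowAt u c (-(1 / 2)) = 1 := by
    apply Units.ext
    rw [coe_flowAt, hc]
    simp
  have hgu := mul_flowAt_neg_half_mem_unitaryGL huc
  rw [h1, mul_one] at hgu
  exact ⟨hMH hg, hgu⟩

/-- For `g = k e^{X/2}` in `H`, the curve `k e^{zX}` lies in `H ∩ U(n)` for imaginary `z`, hence in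
every Zariski closed set containing `H ∩ U(n)` for all `z`. -/
lemma zariskiClosure_inf_unitaryGL (hH : IsZariskiClosed (H : Set (GL (Fin n) ℂ)))
    (hstar : ∀ g ∈ H, star g ∈ H) :
    zariskiClosure ((H ⊓ unitaryGL n : Subgroup (GL (Fin n) ℂ)) : Set (GL (Fin n) ℂ)) = H := by
  refine Set.Subset.antisymm (Set.sInter_subset_of_mem ⟨hH, fun g hg => hg.1⟩) ?_
  rintro g hg Z ⟨hZ, hKZ⟩
  obtain ⟨u, c, huc⟩ := exists_flowAt_one_eq_star_mul_self g
  have hmem : ∀ z, flowAt u c z ∈ H :=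
    flowAt_mem_of_flowAt_one_mem hH (huc ▸ H.mul_mem (hstar g hg) hg)
  rw [← mul_flowAt_neg_half_mul_flowAt_half (u := u) (c := c) g]
  refine hZ.mul_flowAt_mem separatesFrequencies_imaginaryAxis (fun t => hKZ ⟨?_, ?_⟩) _
  · exact H.mul_mem (H.mul_mem hg (hmem _)) (hmem _)
  · exact (unitaryGL n).mul_mem (mul_flowAt_neg_half_mem_unitaryGL huc)
      (flowAt_imaginaryAxis_mem_unitaryGL u c t)

end Unitary

lemma inf_unitaryGL_inf_stab (G : Subgroup (GL (Fin n) ℂ)) (v : EuclideanSpace ℂ (Fin n)) :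
    (G ⊓ unitaryGL n) ⊓ stab G v = stab G v ⊓ unitaryGL n := by
  ext g
  simp only [Subgroup.mem_inf, mem_stab_iff]
  tauto

end KempfNess

/-- Here `star g` is the conjugate transpose `g*`. -/
theorem mainTheorem6 (n : ℕ) (G : Subgroup (GL (Fin n) ℂ))
    (hG : KempfNess.IsZariskiClosed (G : Set (GL (Fin n) ℂ)))
    (hstar : ∀ g ∈ G, star g ∈ G)
    (v : EuclideanSpace ℂ (Fin n)) (hv : KempfNess.IsCritical G v) :
    (∀ g ∈ KempfNess.stab G v, star g ∈ KempfNess.stab G v) ∧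
    KempfNess.IsMaximalCompactIn ((G ⊓ KempfNess.unitaryGL n) ⊓ KempfNess.stab G v)
      (KempfNess.stab G v) ∧
    KempfNess.zariskiClosure
        (((G ⊓ KempfNess.unitaryGL n) ⊓ KempfNess.stab G v :
          Subgroup (GL (Fin n) ℂ)) : Set (GL (Fin n) ℂ)) =
      (KempfNess.stab G v : Set (GL (Fin n) ℂ)) := by
  have hS := KempfNess.isZariskiClosed_stab hG v
  have hSstar : ∀ g ∈ KempfNess.stab G v, star g ∈ KempfNess.stab G v :=
    fun g hg => KempfNess.star_mem_stab hG hstar hv hg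
  rw [KempfNess.inf_unitaryGL_inf_stab]
  exact ⟨hSstar, KempfNess.isMaximalCompactIn_inf_unitaryGL hS hSstar,
    KempfNess.zariskiClosure_inf_unitaryGL hS hSstar⟩
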